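/- Let $V$ be a finite set, $M$ a matroid on $V$ with rank function $r$, and $P=\{x\in\mathbb R^V_{\ge 0} : x(S)\le r(S)\ \forall S\subseteq V,\ x(V)=r(V)\}$ its base polytope; put $B:=\max_{x\in P}\|x\|_2$. Let $(B_i)_{i\in V}$ be subsets of a set $U$, let $w:U\to\mathbb R_{\ge0}$ be summable, let $f(S)=\sum_{u\in\bigcup_{i\in S}B_i}w(u)$ for $S\subseteq V$ be the associated weighted coverage function, and let $\bar F(x)=\sum_{u\in U}w(u)\min\{1,\sum_{i:\,u\in B_i}x_i\}$ be its concave relaxation on $[0,1]^V$. Consider the following algorithm with step sizes $\eta_t$. Start at some (possibly random) $x^{(0)}\in P$. For $t=0,1,2,\dots$ draw a random vector $g_t$ with $\mathbb E[g_t\mid x^{(0)},\dots,x^{(t)}]\in\partial\bar F(x^{(t)})$ (the superdifferential of the concave function $\bar F$ on $[0,1]^V$), and let $x^{(t+1)}$ be the Euclidean projection of $x^{(t)}+\eta_t g_t$ onto $P$. After $T\ge 1$ iterations form $\bar x_T=\frac1T\sum_{t=1}^{T}x^{(t)}$ and apply randomized pipage rounding to $\bar x_T$ to get a random set $S^*$.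 Randomized pipage rounding keeps a point $y\in P$, initially $\bar x_T$, and a set $Q$, initially $V$. While $y$ is not integral: if $Q$ contains no two fractional variables, reset $Q:=V$; then pick two fractional variables $i\neq j$ in $Q$; let $y^+$ be obtained by raising $y_i$ and lowering $y_j$ by the largest common amount $\delta^+$ that stays in $P$, that is, $\delta^+=\min\{y_j,\ \min_{A\ni i,\,A\not\ni j}(r(A)-y(A))\}$, and let $A^+$ be a minimizing $A$, or $\{j\}$ if $y_j$ is smaller than the inner minimum; define $\delta^-,y^-,A^-$ in the same way with $i$ and $j$ exchanged; with probability $\delta^+/(\delta^++\delta^-)$ (read as $0$ if both amounts vanish) replace $(y,Q)$ by $(y^-,Q\cap A^-)$, otherwise by $(y^+,Q\cap A^+)$. At the end return $\{i: y_i=1\}$. The choices of pairs and of minimizing sets are given by an arbitrary rule depending on the current state. Suppose that $\|g_t\|_2\le\rho$ almost surely for all $t$, where $\rho>0$, and let $\varepsilon>0$. Assume that either (a) $\eta_t=B/(\rho\sqrt T)$ for all $t$ and $T\ge B^2\rho^2/\varepsilon^2$, or (b) $\eta_t=B/(\rho\sqrt{t+1})$ for all $t$ and $T\ge 2B^2\rho^2/\varepsilon^2$.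 Then the rounding loop terminates, within $|V|^2$ iterations from every point of $P$; the set $S^*$ is almost surely independent in $M$; and $$\mathbb E[f(S^*)]\ \ge\ \Bigl(1-\frac1e\Bigr)\max_{S\text{ independent in }M}f(S)\;-\;\varepsilon .$$ -/

import Mathlib

open MeasureTheory
open scoped NNReal ENNReal

namespace StochSubmod

noncomputable section

/-! ### Weighted coverage functions and their concave relaxation -/

/-- The weighted coverage function `f(S) = ∑_{u ∈ ⋃_{i ∈ S} B i} w u` on subsets `S` of the index
set `V` of a family `B` of subsets of `U`. -/
def coverage {U V : Type*} (w : U → ℝ) (B : V → Set U) (S : Finset V) : ℝ :=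
  ∑' u, (⋃ i ∈ S, B i).indicator w u

open Classical in
/-- `P_u`, the set of (indices of) members of the family that contain `u`. -/
def members {U V : Type*} [Fintype V] (B : V → Set U) (u : U) : Finset V :=
  Finset.univ.filter fun i => u ∈ B i

/-- The concave relaxation `F̄(x) = ∑_u w u * min {1, ∑_{i ∈ P_u} x_i}`. -/
def concaveRelax {U V : Type*} [Fintype V] (w : U → ℝ) (B : V → Set U)
    (x : EuclideanSpace ℝ V) : ℝ :=
  ∑' u, w u * min 1 (∑ i ∈ members B u, x i)

/-- The unit cube `[0,1]^V`. -/
def cube (V : Type*) : Set (EuclideanSpace ℝ V) :=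
  {x | ∀ i, 0 ≤ x i ∧ x i ≤ 1}

/-- The superdifferential at `x` of a concave function `F` on the cube `[0,1]^V`. -/
def superdiff {V : Type*} [Fintype V] (F : EuclideanSpace ℝ V → ℝ) (x : EuclideanSpace ℝ V) :
    Set (EuclideanSpace ℝ V) :=
  {g | ∀ y ∈ cube V, F y ≤ F x + inner ℝ g (y - x)}

/-! ### Matroid base polytope -/

/-- The rank function of a matroid on a finite type, as a real number. -/
def rk {V : Type*} (M : Matroid V) (S : Finset V) : ℝ :=
  ((M.eRk (S : Set V)).toNat : ℝ)

/-- The base polytope `{x ≥ 0 | x(S) ≤ r(S) for all S, x(V) = r(V)}`. -/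
def basePolytope {V : Type*} [Fintype V] (M : Matroid V) : Set (EuclideanSpace ℝ V) :=
  {x | (∀ i, 0 ≤ x i) ∧ (∀ S : Finset V, ∑ i ∈ S, x i ≤ rk M S) ∧
    ∑ i, x i = rk M Finset.univ}

/-- `max_{x ∈ P} ‖x‖` (Euclidean norm) for the base polytope `P`. -/
def polytopeRadius {V : Type*} [Fintype V] (M : Matroid V) : ℝ :=
  sSup ((fun x => ‖x‖) '' basePolytope M)

/-- `p` is the Euclidean projection of `y` on `K`. -/
def IsProjection {V : Type*} [Fintype V] (K : Set (EuclideanSpace ℝ V))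
    (y p : EuclideanSpace ℝ V) : Prop :=
  p ∈ K ∧ ∀ z ∈ K, ‖p - y‖ ≤ ‖z - y‖

/-- The maximum of `f` over the independent sets of `M` (a finite nonempty family). -/
def optValue {V : Type*} (M : Matroid V) (f : Finset V → ℝ) : ℝ :=
  sSup (f '' {S | M.Indep (S : Set V)})

/-! ### Randomized pipage rounding -/

/-- `i` and `j` are two distinct fractional coordinates of `y` inside `T`. -/
def IsFracPair {V : Type*} (y : EuclideanSpace ℝ V) (T : Finset V) (i j : V) : Prop :=
  i ∈ T ∧ j ∈ T ∧ i ≠ j ∧ 0 < y i ∧ y i < 1 ∧ 0 < y j ∧ y j < 1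

/-- `T` contains at least two fractional coordinates of `y`. -/
def HasFracPair {V : Type*} (y : EuclideanSpace ℝ V) (T : Finset V) : Prop :=
  ∃ i j, IsFracPair y T i j

/-- The arbitrary choices that the rounding procedure leaves open: which two fractional variables
of `T` to modify, and which minimizer `A` of `r(A) - y(A)` over the sets that contain `i` and do
not contain `j` to use. -/
structure PipageRule {V : Type*} (M : Matroid V) where
  pick : EuclideanSpace ℝ V → Finset V → V × V
  pick_spec : ∀ y T, HasFracPair y T → IsFracPair y T (pick y T).1 (pick y T).2
  tight : EuclideanSpace ℝ V → V → V → Finset V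
  tight_spec : ∀ y i j, i ≠ j → i ∈ tight y i j ∧ j ∉ tight y i j ∧
    ∀ A : Finset V, i ∈ A → j ∉ A →
      rk M (tight y i j) - ∑ k ∈ tight y i j, y k ≤ rk M A - ∑ k ∈ A, y k

/-- A state of the procedure: the current point and the current tight set. -/
structure PipageState (V : Type*) where
  y : EuclideanSpace ℝ V
  T : Finset V

section Pipage

variable {V : Type*} {M : Matroid V}

/-- The largest amount `δ` by which `y i` can be increased and `y j` decreased simultaneously:
the smaller of `y j` and the minimum of `r(A) - y(A)` over sets `A` with `i ∈ A`, `j ∉ A`. -/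
def hitAmount (R : PipageRule M) (y : EuclideanSpace ℝ V) (i j : V) : ℝ :=
  min (rk M (R.tight y i j) - ∑ k ∈ R.tight y i j, y k) (y j)

/-- The probability `‖y⁺ - y‖ / ‖y⁺ - y⁻‖ = δ⁺ / (δ⁺ + δ⁻)` of moving to `y⁻`, where `y⁺` (resp.
`y⁻`) results from increasing (resp. decreasing) `y i` and decreasing (resp. increasing) `y j`. -/
def backProb (R : PipageRule M) (y : EuclideanSpace ℝ V) (i j : V) : ℝ≥0 :=
  (hitAmount R y i j).toNNReal / ((hitAmount R y i j).toNNReal + (hitAmount R y j i).toNNReal)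

theorem backProb_le_one (R : PipageRule M) (y : EuclideanSpace ℝ V) (i j : V) :
    backProb R y i j ≤ 1 :=
  div_le_one_of_le₀ le_self_add zero_le

variable [DecidableEq V]

/-- The point after increasing `y i` and decreasing `y j` as much as possible. -/
def hitPoint (R : PipageRule M) (y : EuclideanSpace ℝ V) (i j : V) : EuclideanSpace ℝ V :=
  y + EuclideanSpace.single i (hitAmount R y i j) - EuclideanSpace.single j (hitAmount R y i j)

/-- The constraint that has been hit: `{j}` if `y j` reaches `0` strictly before a rank constraint
becomes tight, and the set `A` whose constraint has become tight otherwise. -/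
def hitSet (R : PipageRule M) (y : EuclideanSpace ℝ V) (i j : V) : Finset V :=
  if y j < rk M (R.tight y i j) - ∑ k ∈ R.tight y i j, y k then {j} else R.tight y i j

/-- The biased coin: `true` with probability `p`, `false` with probability `1 - p`. -/
def coin (p : ℝ≥0) (hp : p ≤ 1) : PMF Bool :=
  PMF.ofFintype (fun b => ((if b then p else 1 - p : ℝ≥0) : ℝ≥0∞)) (by
    simp only [Fintype.sum_bool, if_true, Bool.false_eq_true, if_false]
    rw [← ENNReal.coe_add, add_tsub_cancel_of_le hp, ENNReal.coe_one])

/-- The random move on the pair `i, j`: with probability `backProb` go to `y⁻`, otherwise to `y⁺`,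
and intersect the tight set with the constraint that has been hit. -/
def pipageMove (R : PipageRule M) (s : PipageState V) (i j : V) : PMF (PipageState V) :=
  (coin (backProb R s.y i j) (backProb_le_one R s.y i j)).map fun b =>
    if b then ⟨hitPoint R s.y j i, s.T ∩ hitSet R s.y j i⟩
    else ⟨hitPoint R s.y i j, s.T ∩ hitSet R s.y i j⟩

variable [Fintype V]

open Classical in
/-- One iteration. If `T` contains two fractional variables, a move is made inside `T`; if it does
not, `T` is first reset to the whole ground set; nothing happens if the ground set does not contain
two fractional variables either (on the base polytope this means that `y` is integral, as the
coordinates sum to an integer). -/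
def pipageStep (R : PipageRule M) (s : PipageState V) : PMF (PipageState V) :=
  if HasFracPair s.y s.T then
    pipageMove R s (R.pick s.y s.T).1 (R.pick s.y s.T).2
  else if HasFracPair s.y Finset.univ then
    pipageMove R ⟨s.y, Finset.univ⟩ (R.pick s.y Finset.univ).1 (R.pick s.y Finset.univ).2
  else PMF.pure s

/-- The law of the state after `n` iterations from the state `s`. -/
def pipageRun (R : PipageRule M) : ℕ → PipageState V → PMF (PipageState V)
  | 0, s => PMF.pure s
  | n + 1, s => (pipageStep R s).bind (pipageRun R n)

/-- The law of the set returned by randomized pipage rounding of `y`: the set of coordinates equal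
to `1` at the end of the loop. Each pass of the loop over `T` starts with `T` the ground set, takes
at most `|V|` moves (each removes an element from `T`), and makes at least one more variable
integral, so that the loop is over after `|V|^2` iterations; further iterations change nothing. -/
def pipageRound (R : PipageRule M) (y : EuclideanSpace ℝ V) : PMF (Finset V) :=
  (pipageRun R (Fintype.card V ^ 2) ⟨y, Finset.univ⟩).map fun s =>
    Finset.univ.filter fun i => s.y i = 1

end Pipage

/-! ### The algorithm -/

/-- The `σ`-algebra generated by `x 0, …, x t`. -/
abbrev history {Ω E : Type*} [MeasurableSpace E] (x : ℕ → Ω → E) (t : ℕ) : MeasurableSpace Ω :=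
  ⨆ s : Fin (t + 1), MeasurableSpace.comap (x s) inferInstance

/-- The average `(1/T) ∑_{t=1}^{T} x t`. -/
def average {Ω E : Type*} [AddCommGroup E] [Module ℝ E] (x : ℕ → Ω → E) (T : ℕ) (ω : Ω) : E :=
  (T : ℝ)⁻¹ • ∑ t ∈ Finset.Icc 1 T, x t ω

/-- A run, on the probability space `(Ω, μ)`, of projected stochastic subgradient ascent on the
concave function `F` over the base polytope of `M` with step sizes `η` and stochastic gradients
`g` of norm at most `ρ`, followed by randomized pipage rounding of the average of the first `T`
iterates, which returns the random set `S`. -/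
structure IsRun {V : Type*} [Fintype V] [DecidableEq V] (M : Matroid V)
    (F : EuclideanSpace ℝ V → ℝ) (R : PipageRule M) (η : ℕ → ℝ) (ρ : ℝ) (T : ℕ)
    {Ω : Type*} [MeasurableSpace Ω] (μ : Measure Ω)
    (x g : ℕ → Ω → EuclideanSpace ℝ V) (S : Ω → Finset V) : Prop where
  measurable_x : ∀ t, Measurable (x t)
  measurable_g : ∀ t, Measurable (g t)
  measurable_S : Measurable S
  /-- the starting point lies in the polytope -/
  start : ∀ ω, x 0 ω ∈ basePolytope M
  /-- the conditional mean of the stochastic gradient given the past is a supergradient -/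
  unbiased : ∀ t, ∀ᵐ ω ∂μ, (μ[g t | history x t]) ω ∈ superdiff F (x t ω)
  /-- the stochastic gradients are bounded by `ρ` with probability one -/
  bounded : ∀ t, ∀ᵐ ω ∂μ, ‖g t ω‖ ≤ ρ
  /-- ascent step followed by projection -/
  step : ∀ t ω, IsProjection (basePolytope M) (x t ω + η t • g t ω) (x (t + 1) ω)
  /-- given the average iterate, `S` is distributed as the output of the rounding procedure -/
  round : ∀ A : Finset V,
    μ[(S ⁻¹' {A}).indicator (fun _ => (1 : ℝ)) |
        MeasurableSpace.comap (average x T) inferInstance]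
      =ᵐ[μ] fun ω => (pipageRound R (average x T ω) A).toReal

end

end StochSubmod

open StochSubmod

set_option linter.unusedSectionVars false

namespace StochSubmod

/-! ### Matroid rank and the base polytope -/

section Rank

variable {V : Type*}

/-! Two losses are combined: an additive one from the ascent and a multiplicative one from the
rounding. Ascent: extend an optimal independent set to a base and let `z` be its indicator vector,
where the relaxation is at least the optimum. Projection does not increase the distance to `z`, and
the conditional mean of the gradient is a supergradient, so the expected squared distance telescopes
against the optimality gaps. Since `basePolytope M` lies in the nonnegative orthant, squared
distances are at most `2 * polytopeRadius M ^ 2`. Concavity passes from the iterates to their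
average, giving an expected gap of at most `3 / 2 * ε` (`IsRun.sum_gap_le`,
`IsRun.le_integral_average`). Rounding: each move is a mean-zero step along `e_i - e_j`, a direction
in which `∏ k ∈ A, (1 - y k)` is concave. Hence the probability that the output misses `A` is at
most this product at the starting point, and `1 - ∏ (1 - y k) ≥ (1 - 1/e) * min 1 (∑ y k)` is
applied to each class of points of `U` (`expect_pipageMove_le`, `concaveRelax_le_sum_pipageRound`).
Termination comes from uncrossing tight sets: each move shrinks the current set, and a set without
two fractional coordinates is left only after a coordinate has become integral (`move_spec`). The
factor `1 - 1/e` also multiplies the additive loss, and `(1 - 1/e) * 3/2 ≤ 1` because `e ≤ 3`. -/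

lemma cast_rk (M : Matroid V) (S : Finset V) :
    (((M.eRk (S : Set V)).toNat : ℕ) : ℕ∞) = M.eRk (S : Set V) := by
  refine ENat.natCast_toNat (ne_top_of_le_ne_top ?_ (M.eRk_le_encard _))
  simp [Set.encard_coe_eq_coe_finsetCard]

lemma rk_le_card (M : Matroid V) (S : Finset V) : rk M S ≤ S.card := by
  have h := M.eRk_le_encard (S : Set V)
  rw [← cast_rk, Set.encard_coe_eq_coe_finsetCard] at h
  unfold rk
  exact_mod_cast h

lemma rk_submod [DecidableEq V] (M : Matroid V) (S T : Finset V) :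
    rk M (S ∩ T) + rk M (S ∪ T) ≤ rk M S + rk M T := by
  have h := M.eRk_submod (S : Set V) (T : Set V)
  rw [← Finset.coe_inter, ← Finset.coe_union] at h
  rw [← cast_rk M (S ∩ T), ← cast_rk M (S ∪ T), ← cast_rk M S, ← cast_rk M T] at h
  unfold rk
  exact_mod_cast h

lemma indep_of_card_le_rk (M : Matroid V) (S : Finset V) (h : (S.card : ℝ) ≤ rk M S) :
    M.Indep (S : Set V) := by
  rw [M.indep_iff_eRk_eq_encard_of_finite S.finite_toSet]
  refine le_antisymm (M.eRk_le_encard _) ?_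
  rw [← cast_rk, Set.encard_coe_eq_coe_finsetCard]
  unfold rk at h
  exact_mod_cast h

lemma card_le_rk_of_indep (M : Matroid V) {S A : Finset V} (h : M.Indep (S : Set V))
    (hSA : S ⊆ A) : (S.card : ℝ) ≤ rk M A := by
  have h := h.encard_le_eRk_of_subset (X := (A : Set V)) (by exact_mod_cast hSA)
  rw [← cast_rk, Set.encard_coe_eq_coe_finsetCard] at h
  unfold rk
  exact_mod_cast h

/-- The indicator vector of a finite set. -/
noncomputable def indVec [DecidableEq V] (S : Finset V) : EuclideanSpace ℝ V :=
  WithLp.toLp 2 fun i => if i ∈ S then 1 else 0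

lemma indVec_apply [DecidableEq V] (S : Finset V) (i : V) :
    indVec S i = if i ∈ S then 1 else 0 := rfl

lemma sum_indVec [DecidableEq V] (S A : Finset V) :
    ∑ i ∈ A, indVec S i = ((A ∩ S).card : ℝ) := by
  simp [indVec_apply]

variable [Fintype V] {M : Matroid V} {y : EuclideanSpace ℝ V}

lemma le_one_of_mem_basePolytope (hy : y ∈ basePolytope M) (i : V) : y i ≤ 1 := by
  have h := (hy.2.1 {i}).trans (rk_le_card M {i})
  simpa using h

lemma basePolytope_subset_cube (M : Matroid V) : basePolytope M ⊆ cube V :=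
  fun _ hy i => ⟨hy.1 i, le_one_of_mem_basePolytope hy i⟩

lemma convex_basePolytope (M : Matroid V) : Convex ℝ (basePolytope M) := by
  intro x hx y hy a b ha hb hab
  have hsum : ∀ S : Finset V, ∑ i ∈ S, (a • x + b • y) i = a * ∑ i ∈ S, x i + b * ∑ i ∈ S, y i := by
    intro S
    simp [Finset.sum_add_distrib, Finset.mul_sum]
  refine ⟨fun i => ?_, fun S => ?_, ?_⟩
  · have := mul_nonneg ha (hx.1 i)
    have := mul_nonneg hb (hy.1 i)
    simp only [PiLp.add_apply, PiLp.smul_apply, smul_eq_mul]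
    positivity
  · rw [hsum]
    have h1 := mul_le_mul_of_nonneg_left (hx.2.1 S) ha
    have h2 := mul_le_mul_of_nonneg_left (hy.2.1 S) hb
    have h3 : a * rk M S + b * rk M S = rk M S := by rw [← add_mul, hab, one_mul]
    linarith
  · rw [hsum, hx.2.2, hy.2.2, ← add_mul, hab, one_mul]

lemma norm_sq_le_of_mem_basePolytope (hy : y ∈ basePolytope M) : ‖y‖ ^ 2 ≤ Fintype.card V := by
  rw [EuclideanSpace.norm_sq_eq]
  calc ∑ i, ‖y i‖ ^ 2 ≤ ∑ _i : V, (1 : ℝ) := by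
        refine Finset.sum_le_sum fun i _ => ?_
        rw [Real.norm_eq_abs, sq_abs]
        nlinarith [hy.1 i, le_one_of_mem_basePolytope hy i]
    _ = _ := by simp

lemma norm_le_polytopeRadius (hy : y ∈ basePolytope M) : ‖y‖ ≤ polytopeRadius M := by
  refine le_csSup ⟨√(Fintype.card V), ?_⟩ ⟨y, hy, rfl⟩
  rintro _ ⟨z, hz, rfl⟩
  exact Real.le_sqrt_of_sq_le (norm_sq_le_of_mem_basePolytope hz)

lemma polytopeRadius_nonneg (M : Matroid V) : 0 ≤ polytopeRadius M := by
  refine Real.sSup_nonneg ?_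
  rintro _ ⟨z, _, rfl⟩
  exact norm_nonneg z

/-- Nonnegative vectors have nonnegative inner product, so the cross term can be dropped. The
triangle inequality alone would give the constant 4, too weak for the final `ε`. -/
lemma norm_sub_sq_le_of_mem_basePolytope {z : EuclideanSpace ℝ V} (hy : y ∈ basePolytope M)
    (hz : z ∈ basePolytope M) : ‖y - z‖ ^ 2 ≤ 2 * polytopeRadius M ^ 2 := by
  have hin : 0 ≤ inner ℝ y z := by
    rw [PiLp.inner_apply]
    exact Finset.sum_nonneg fun i _ => by simpa using mul_nonneg (hz.1 i) (hy.1 i)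
  have h1 := pow_le_pow_left₀ (norm_nonneg y) (norm_le_polytopeRadius hy) 2
  have h2 := pow_le_pow_left₀ (norm_nonneg z) (norm_le_polytopeRadius hz) 2
  rw [norm_sub_sq_real]
  linarith

/-- The intersection of two tight sets is tight. -/
lemma tight_inter [DecidableEq V] (hy : y ∈ basePolytope M) {S T : Finset V}
    (hS : ∑ i ∈ S, y i = rk M S) (hT : ∑ i ∈ T, y i = rk M T) :
    ∑ i ∈ S ∩ T, y i = rk M (S ∩ T) := by
  have h1 := rk_submod M S T
  have h2 := hy.2.1 (S ∩ T)
  have h3 := hy.2.1 (S ∪ T)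
  have h4 := Finset.sum_union_inter (s₁ := S) (s₂ := T) (f := fun i => y i)
  linarith

lemma exists_superset_indVec_mem_basePolytope [DecidableEq V] {S : Finset V}
    (hS : M.Indep (S : Set V)) :
    ∃ S' : Finset V, S ⊆ S' ∧ indVec S' ∈ basePolytope M := by
  obtain ⟨I, hI, hSI⟩ := hS.exists_isBase_superset
  have hfin : I.Finite := Set.toFinite I
  have hind : M.Indep (hfin.toFinset : Set V) := by simpa using hI.indep
  refine ⟨hfin.toFinset, by simpa [← Finset.coe_subset] using hSI, fun i => ?_, fun A => ?_, ?_⟩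
  · rw [indVec_apply]; split_ifs <;> simp
  · rw [sum_indVec]
    exact card_le_rk_of_indep M (hind.subset (by simp)) Finset.inter_subset_left
  · rw [sum_indVec, Finset.univ_inter]
    refine le_antisymm (card_le_rk_of_indep M hind (Finset.subset_univ _)) ?_
    have h := hI.encard_eq_eRank
    have h2 := M.eRk_univ_eq
    rw [← Finset.coe_univ] at h2
    rw [← h2, ← cast_rk, ← hfin.coe_toFinset, Set.encard_coe_eq_coe_finsetCard] at h
    unfold rk
    exact_mod_cast h.ge

end Rank

/-! ### Coverage functions as finite sums -/

section Coverage

variable {U V : Type*} [Fintype V]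

open Classical in
/-- The total weight of the points that lie in `B i` exactly for `i ∈ A`. -/
noncomputable def classWeight (w : U → ℝ) (B : V → Set U) (A : Finset V) : ℝ :=
  ∑' u, if members B u = A then w u else 0

lemma classWeight_nonneg {w : U → ℝ} (hw : ∀ u, 0 ≤ w u) (B : V → Set U) (A : Finset V) :
    0 ≤ classWeight w B A :=
  tsum_nonneg fun u => by split_ifs <;> simp [hw]

/-- Coverage and its relaxation see a point `u` only through `members B u`, which takes finitely
many values. Grouping by that value turns both series into finite sums with nonnegative
coefficients, so later arguments work one class at a time. -/
lemma tsum_mul_members {w : U → ℝ} (hw : ∀ u, 0 ≤ w u) (hsum : Summable w) (B : V → Set U)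
    (φ : Finset V → ℝ) :
    ∑' u, w u * φ (members B u) = ∑ A, classWeight w B A * φ A := by
  classical
  have h : ∀ A, Summable fun u => (if members B u = A then w u else 0) * φ A := fun A =>
    (Summable.of_nonneg_of_le (fun u => by split_ifs <;> simp [hw])
      (fun u => by split_ifs <;> simp [hw]) hsum).mul_right _
  calc ∑' u, w u * φ (members B u)
      = ∑' u, ∑ A, (if members B u = A then w u else 0) * φ A := by
        congr 1 with u
        simp [ite_mul]
    _ = ∑ A, ∑' u, (if members B u = A then w u else 0) * φ A :=
        Summable.tsum_finsetSum fun A _ => h A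
    _ = _ := by
        refine Finset.sum_congr rfl fun A _ => ?_
        rw [tsum_mul_right, classWeight]

lemma concaveRelax_eq_sum {w : U → ℝ} (hw : ∀ u, 0 ≤ w u) (hsum : Summable w) (B : V → Set U)
    (x : EuclideanSpace ℝ V) :
    concaveRelax w B x = ∑ A, classWeight w B A * min 1 (∑ i ∈ A, x i) :=
  tsum_mul_members hw hsum B fun A => min 1 (∑ i ∈ A, x i)

lemma coverage_eq_sum [DecidableEq V] {w : U → ℝ} (hw : ∀ u, 0 ≤ w u) (hsum : Summable w)
    (B : V → Set U) (S : Finset V) :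
    coverage w B S = ∑ A, classWeight w B A * (if Disjoint A S then 0 else 1) := by
  rw [← tsum_mul_members hw hsum B fun A => if Disjoint A S then 0 else 1, coverage]
  congr 1 with u
  have h : u ∈ (⋃ i ∈ S, B i) ↔ ¬ Disjoint (members B u) S := by
    simp [Finset.not_disjoint_iff, members, and_comm]
  by_cases hu : Disjoint (members B u) S
  · simp [hu, Set.indicator_of_notMem (fun h' => h.1 h' hu)]
  · rw [Set.indicator_of_mem (h.2 hu)]; simp [hu]

lemma coverage_mono {w : U → ℝ} (hw : ∀ u, 0 ≤ w u) (hsum : Summable w)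
    (B : V → Set U) : Monotone (coverage w B) := by
  classical
  intro S S' hS
  rw [coverage_eq_sum hw hsum, coverage_eq_sum hw hsum]
  refine Finset.sum_le_sum fun A _ => mul_le_mul_of_nonneg_left ?_ (classWeight_nonneg hw B A)
  by_cases h : Disjoint A S'
  · simp [h, h.mono_right hS]
  · simp only [h, if_false]; split_ifs <;> simp

lemma coverage_le_concaveRelax_indVec [DecidableEq V] {w : U → ℝ} (hw : ∀ u, 0 ≤ w u)
    (hsum : Summable w) (B : V → Set U) (S : Finset V) :
    coverage w B S ≤ concaveRelax w B (indVec S) := by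
  rw [coverage_eq_sum hw hsum, concaveRelax_eq_sum hw hsum]
  refine Finset.sum_le_sum fun A _ => mul_le_mul_of_nonneg_left ?_ (classWeight_nonneg hw B A)
  rw [sum_indVec]
  split_ifs with h
  · exact le_min zero_le_one (Nat.cast_nonneg _)
  · refine le_min le_rfl ?_
    rw [Finset.disjoint_iff_inter_eq_empty, ← ne_eq, ← Finset.nonempty_iff_ne_empty,
      ← Finset.card_pos] at h
    exact_mod_cast h

lemma exists_optValue_le_concaveRelax {w : U → ℝ} (hw : ∀ u, 0 ≤ w u) (hsum : Summable w)
    (B : V → Set U) (M : Matroid V) :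
    ∃ z ∈ basePolytope M, optValue M (coverage w B) ≤ concaveRelax w B z := by
  classical
  have hne : (coverage w B '' {S | M.Indep (S : Set V)}).Nonempty :=
    ⟨_, ∅, by simp, rfl⟩
  obtain ⟨S, hS, hval⟩ := hne.csSup_mem (Set.toFinite _)
  obtain ⟨S', hSS, hmem⟩ := exists_superset_indVec_mem_basePolytope hS
  refine ⟨_, hmem, ?_⟩
  rw [optValue, ← hval]
  exact (coverage_mono hw hsum B hSS).trans (coverage_le_concaveRelax_indVec hw hsum B S')

lemma continuous_concaveRelax {w : U → ℝ} (hw : ∀ u, 0 ≤ w u) (hsum : Summable w)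
    (B : V → Set U) : Continuous (concaveRelax w B) := by
  simp_rw [funext (concaveRelax_eq_sum hw hsum B)]
  fun_prop

lemma concaveOn_concaveRelax {w : U → ℝ} (hw : ∀ u, 0 ≤ w u) (hsum : Summable w)
    (B : V → Set U) : ConcaveOn ℝ Set.univ (concaveRelax w B) := by
  refine ⟨convex_univ, fun x _ y _ a b ha hb hab => ?_⟩
  simp_rw [concaveRelax_eq_sum hw hsum B, smul_eq_mul, Finset.mul_sum]
  rw [← Finset.sum_add_distrib]
  refine Finset.sum_le_sum fun A _ => ?_
  have hs : ∑ i ∈ A, (a • x + b • y) i = a * ∑ i ∈ A, x i + b * ∑ i ∈ A, y i := by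
    simp [Finset.sum_add_distrib, Finset.mul_sum]
  rw [hs, mul_left_comm a, mul_left_comm b, ← mul_add]
  refine mul_le_mul_of_nonneg_left (le_min ?_ ?_) (classWeight_nonneg hw B A)
  · nlinarith [min_le_left 1 (∑ i ∈ A, x i), min_le_left 1 (∑ i ∈ A, y i)]
  · nlinarith [min_le_right 1 (∑ i ∈ A, x i), min_le_right 1 (∑ i ∈ A, y i)]

/-- `(1 - 1/e) min {1, ∑ y_i} ≤ 1 - ∏ (1 - y_i)` for `y_i ∈ [0, 1]`. -/
lemma mul_min_one_sum_le_one_sub_prod {ι : Type*} (A : Finset ι) (y : ι → ℝ)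
    (h0 : ∀ i, 0 ≤ y i) (h1 : ∀ i, y i ≤ 1) :
    (1 - 1 / Real.exp 1) * min 1 (∑ i ∈ A, y i) ≤ 1 - ∏ i ∈ A, (1 - y i) := by
  have hprod : ∏ i ∈ A, (1 - y i) ≤ Real.exp (-∑ i ∈ A, y i) := by
    rw [← Finset.sum_neg_distrib, Real.exp_sum]
    exact Finset.prod_le_prod (fun i _ => sub_nonneg.2 (h1 i))
      fun i _ => Real.one_sub_le_exp_neg (y i)
  have hs : 0 ≤ ∑ i ∈ A, y i := Finset.sum_nonneg fun i _ => h0 i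
  set s := ∑ i ∈ A, y i
  have he : 1 / Real.exp 1 = Real.exp (-1) := by rw [Real.exp_neg, one_div]
  rw [he]
  rcases le_total s 1 with hs1 | hs1
  -- On `[0, 1]` the convex function `exp (-s)` lies below its chord `1 - (1 - 1/e) * s`.
  · have hc := convexOn_exp.2 (Set.mem_univ 0) (Set.mem_univ (-1 : ℝ)) (sub_nonneg.2 hs1) hs
      (by ring)
    simp only [smul_eq_mul, mul_zero, zero_add, mul_neg, mul_one, Real.exp_zero] at hc
    rw [min_eq_right hs1]
    linarith
  · have := Real.exp_le_exp.2 (neg_le_neg hs1)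
    rw [min_eq_left hs1]
    linarith

end Coverage

/-! ### Expectations under a probability mass function -/

section Expect

variable {α β : Type*}

/-- The expectation of `H` under `p`. -/
noncomputable def expect (p : PMF α) (H : α → ℝ≥0∞) : ℝ≥0∞ := ∑' a, p a * H a

lemma expect_pure (a : α) (H : α → ℝ≥0∞) : expect (PMF.pure a) H = H a := by
  classical
  rw [expect, tsum_eq_single a fun b hb => by simp [PMF.pure_apply, hb]]
  simp

/-- With values in `ℝ≥0∞` the sums can be interchanged without summability conditions, although the
type of states is infinite. -/
lemma expect_bind (p : PMF α) (q : α → PMF β) (H : β → ℝ≥0∞) :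
    expect (p.bind q) H = expect p fun a => expect (q a) H := by
  simp_rw [expect, PMF.bind_apply, ← ENNReal.tsum_mul_right, ← ENNReal.tsum_mul_left]
  rw [ENNReal.tsum_comm]
  simp_rw [mul_assoc]

lemma expect_map (p : PMF α) (φ : α → β) (H : β → ℝ≥0∞) :
    expect (p.map φ) H = expect p (H ∘ φ) := by
  rw [PMF.map, expect_bind]
  simp_rw [Function.comp_apply, expect_pure]
  rfl

lemma expect_mono {p : PMF α} {H K : α → ℝ≥0∞} (h : ∀ a ∈ p.support, H a ≤ K a) :
    expect p H ≤ expect p K := by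
  refine ENNReal.tsum_le_tsum fun a => ?_
  by_cases ha : a ∈ p.support
  · exact mul_le_mul_right (h a ha) _
  · rw [PMF.mem_support_iff, not_not] at ha
    simp [ha]

lemma expect_coin (q : ℝ≥0) (hq : q ≤ 1) (H : Bool → ℝ≥0∞) :
    expect (coin q hq) H = q * H true + (1 - q : ℝ≥0) * H false := by
  simp [expect, tsum_fintype, coin]

end Expect

/-! ### A single move of pipage rounding -/

section Move

variable {V : Type*} {M : Matroid V}

lemma IsFracPair.symm {y : EuclideanSpace ℝ V} {T : Finset V} {i j : V}
    (h : IsFracPair y T i j) : IsFracPair y T j i :=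
  ⟨h.2.1, h.1, h.2.2.1.symm, h.2.2.2.2.2.1, h.2.2.2.2.2.2, h.2.2.2.1, h.2.2.2.2.1⟩

variable [DecidableEq V] (R : PipageRule M)

lemma hitPoint_apply (y : EuclideanSpace ℝ V) (i j k : V) :
    hitPoint R y i j k =
      y k + (if k = i then hitAmount R y i j else 0) - (if k = j then hitAmount R y i j else 0) := by
  simp [hitPoint]

lemma sum_hitPoint (y : EuclideanSpace ℝ V) (i j : V) (S : Finset V) :
    ∑ k ∈ S, hitPoint R y i j k = ∑ k ∈ S, y k + (if i ∈ S then hitAmount R y i j else 0)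
      - (if j ∈ S then hitAmount R y i j else 0) := by
  simp [hitPoint_apply, Finset.sum_add_distrib]

variable [Fintype V] {R} {y : EuclideanSpace ℝ V} {i j : V}

lemma hitAmount_nonneg (hy : y ∈ basePolytope M) (i j : V) : 0 ≤ hitAmount R y i j :=
  le_min (sub_nonneg.2 (hy.2.1 _)) (hy.1 j)

lemma hitPoint_mem_basePolytope (hy : y ∈ basePolytope M) (hij : i ≠ j) :
    hitPoint R y i j ∈ basePolytope M := by
  have h0 := hitAmount_nonneg (R := R) hy i j
  refine ⟨fun k => ?_, fun S => ?_, ?_⟩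
  · rw [hitPoint_apply]
    have hk := hy.1 k
    have hj : hitAmount R y i j ≤ y j := min_le_right _ _
    split_ifs with h1 h2 h2
    · linarith
    · linarith
    · subst h2; linarith
    · linarith
  · rw [sum_hitPoint]
    have hS := hy.2.1 S
    split_ifs with h1 h2 h2
    · linarith
    · have h3 := (R.tight_spec y i j hij).2.2 S h1 h2
      have h4 : hitAmount R y i j ≤ _ := min_le_left _ _
      linarith
    · linarith
    · linarith
  · rw [sum_hitPoint, ← hy.2.2]
    simp

lemma hitSet_spec (R : PipageRule M) (y : EuclideanSpace ℝ V) (hij : i ≠ j) :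
    (hitSet R y i j = {j} ∧ hitPoint R y i j j = 0) ∨
      (i ∈ hitSet R y i j ∧ j ∉ hitSet R y i j ∧
        ∑ k ∈ hitSet R y i j, hitPoint R y i j k = rk M (hitSet R y i j)) := by
  obtain ⟨h1, h2, -⟩ := R.tight_spec y i j hij
  by_cases h : y j < rk M (R.tight y i j) - ∑ k ∈ R.tight y i j, y k
  · left
    refine ⟨if_pos h, ?_⟩
    rw [hitPoint_apply]
    simp [hij.symm, hitAmount, min_eq_right h.le]
  · right
    rw [hitSet, if_neg h, sum_hitPoint, if_pos h1, if_neg h2, hitAmount, min_eq_left (not_lt.1 h)]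
    exact ⟨h1, h2, by ring⟩

/-- A tight set with at most one fractional coordinate has none. -/
lemma integral_of_tight_of_not_hasFracPair (hy : y ∈ basePolytope M) {T : Finset V}
    (hT : ∑ k ∈ T, y k = rk M T) (h : ¬ HasFracPair y T) (hi : i ∈ T) : y i = 0 ∨ y i = 1 := by
  by_contra! hne
  have hi0 : 0 < y i := lt_of_le_of_ne (hy.1 i) hne.1.symm
  have hi1 : y i < 1 := lt_of_le_of_ne (le_one_of_mem_basePolytope hy i) hne.2
  -- All other coordinates in `T` are 0 or 1 and the total is an integer rank, so `y i` would be an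
  -- integer strictly between 0 and 1.
  have hint : ∀ k ∈ T.erase i, y k = ((if y k = 1 then 1 else 0 : ℤ) : ℝ) := by
    intro k hk
    rw [Finset.mem_erase] at hk
    split_ifs with hk1
    · simpa using hk1
    · by_contra hk0
      refine h ⟨i, k, hi, hk.2, hk.1.symm, hi0, hi1, lt_of_le_of_ne (hy.1 k) ?_,
        lt_of_le_of_ne (le_one_of_mem_basePolytope hy k) hk1⟩
      simpa using Ne.symm hk0
  rw [← Finset.add_sum_erase _ _ hi, Finset.sum_congr rfl hint, ← Int.cast_sum, rk] at hT
  set m : ℤ := ∑ k ∈ T.erase i, if y k = 1 then 1 else 0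
  set r := (M.eRk (T : Set V)).toNat
  have h1 : (m : ℝ) < (r : ℤ) := by push_cast; linarith
  have h2 : ((r : ℤ) : ℝ) < m + 1 := by push_cast; linarith
  norm_cast at h1 h2
  omega

/-- The fractional coordinates of `y`. -/
noncomputable def fracs (y : EuclideanSpace ℝ V) : Finset V :=
  Finset.univ.filter fun i => 0 < y i ∧ y i < 1

lemma mem_fracs : i ∈ fracs y ↔ 0 < y i ∧ y i < 1 := by simp [fracs]

lemma fracs_hitPoint_subset {T : Finset V} (hf : IsFracPair y T i j) :
    fracs (hitPoint R y i j) ⊆ fracs y := by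
  intro k hk
  obtain ⟨-, -, -, h1, h2, h3, h4⟩ := hf
  rw [mem_fracs] at hk ⊢
  by_cases hki : k = i
  · subst hki; exact ⟨h1, h2⟩
  by_cases hkj : k = j
  · subst hkj; exact ⟨h3, h4⟩
  simpa [hitPoint_apply, hki, hkj] using hk

/-- If `y j` reaches 0, the new set is `{j}`. Otherwise it is `T ∩ A` with `A` newly tight; `T`
stays tight because both `i` and `j` lie in it, so the intersection is tight. It has lost `j` and
kept `i`, and if it has no fractional pair then `i` itself has become integral. -/
lemma move_spec (hy : y ∈ basePolytope M) {T : Finset V} (hT : ∑ k ∈ T, y k = rk M T)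
    (hf : IsFracPair y T i j) :
    (T ∩ hitSet R y i j).card < T.card ∧
      (∑ k ∈ T ∩ hitSet R y i j, hitPoint R y i j k = rk M (T ∩ hitSet R y i j) ∨
        ¬ HasFracPair (hitPoint R y i j) (T ∩ hitSet R y i j)) ∧
      (¬ HasFracPair (hitPoint R y i j) (T ∩ hitSet R y i j) →
        (fracs (hitPoint R y i j)).card < (fracs y).card) := by
  have hij := hf.2.2.1
  have hfi : i ∈ fracs y := mem_fracs.2 ⟨hf.2.2.2.1, hf.2.2.2.2.1⟩
  have hfj : j ∈ fracs y := mem_fracs.2 hf.2.2.2.2.2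
  have hlt : ∀ k ∈ fracs y, (hitPoint R y i j k = 0 ∨ hitPoint R y i j k = 1) →
      (fracs (hitPoint R y i j)).card < (fracs y).card := by
    intro k hk h
    refine Finset.card_lt_card ⟨fracs_hitPoint_subset hf, fun hsub => ?_⟩
    have := mem_fracs.1 (hsub hk)
    rcases h with h | h <;> rw [h] at this <;> linarith
  rcases hitSet_spec R y hij with ⟨h1, h2⟩ | ⟨h1, h2, h3⟩
  · rw [h1, Finset.inter_singleton_of_mem hf.2.1]
    refine ⟨?_, Or.inr ?_, fun _ => hlt j hfj (Or.inl h2)⟩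
    · rw [Finset.card_singleton, Finset.one_lt_card]
      exact ⟨i, hf.1, j, hf.2.1, hij⟩
    · rintro ⟨a, b, ha, hb, hab, -⟩
      exact hab ((Finset.mem_singleton.1 ha).trans (Finset.mem_singleton.1 hb).symm)
  · have hmem := hitPoint_mem_basePolytope (R := R) hy hij
    have hTt : ∑ k ∈ T, hitPoint R y i j k = rk M T := by
      rw [sum_hitPoint, if_pos hf.1, if_pos hf.2.1, hT]; ring
    have htight := tight_inter hmem hTt h3
    refine ⟨Finset.card_lt_card ⟨Finset.inter_subset_left, fun hsub => ?_⟩, Or.inl htight,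
      fun hno => hlt i hfi ?_⟩
    · exact h2 (Finset.mem_inter.1 (hsub hf.2.1)).2
    · exact integral_of_tight_of_not_hasFracPair hmem htight hno (Finset.mem_inter.2 ⟨hf.1, h1⟩)

/-- Along a direction `e_i - e_j` the product `∏ (1 - y_k)` is a concave quadratic. -/
lemma exists_prod_shift_eq (hy : ∀ k, y k ≤ 1) (hij : i ≠ j) (A : Finset V) :
    ∃ β γ : ℝ, 0 ≤ γ ∧ ∀ t : ℝ,
      ∏ k ∈ A, (1 - (y k + (if k = i then t else 0) - (if k = j then t else 0))) =
        ∏ k ∈ A, (1 - y k) + β * t - γ * t ^ 2 := by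
  have hsplit : ∀ φ : V → ℝ, ∏ k ∈ A, φ k =
      (if i ∈ A then φ i else 1) * ((if j ∈ A then φ j else 1) *
        ∏ k ∈ (A.erase i).erase j, φ k) := by
    intro φ
    have h1 : ∀ (S : Finset V) (a : V),
        ∏ k ∈ S, φ k = (if a ∈ S then φ a else 1) * ∏ k ∈ S.erase a, φ k := by
      intro S a
      split_ifs with h
      · rw [Finset.mul_prod_erase _ _ h]
      · rw [Finset.erase_eq_of_notMem h, one_mul]
    rw [h1 A i, h1 (A.erase i) j]
    simp [hij.symm]
  have hrest : ∀ t : ℝ, ∏ k ∈ (A.erase i).erase j,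
      (1 - (y k + (if k = i then t else 0) - (if k = j then t else 0))) =
        ∏ k ∈ (A.erase i).erase j, (1 - y k) := by
    intro t
    refine Finset.prod_congr rfl fun k hk => ?_
    simp only [Finset.mem_erase] at hk
    simp [hk.1, hk.2.1]
  have hC : 0 ≤ ∏ k ∈ (A.erase i).erase j, (1 - y k) :=
    Finset.prod_nonneg fun k _ => sub_nonneg.2 (hy k)
  simp_rw [hsplit (fun k => 1 - y k),
    hsplit (fun k => 1 - (y k + (if k = i then _ else 0) - (if k = j then _ else 0))), hrest]
  set C := ∏ k ∈ (A.erase i).erase j, (1 - y k)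
  by_cases hi : i ∈ A <;> by_cases hj : j ∈ A
  -- Only this case has a quadratic term: with `a = 1 - y i` and `b = 1 - y j`, the two moving
  -- factors are `(a - t) * (b + t) = a * b + (a - b) * t - t ^ 2`.
  · exact ⟨C * ((1 - y i) - (1 - y j)), C, hC, fun t => by simp [hi, hj, hij, hij.symm]; ring⟩
  · exact ⟨-C, 0, le_rfl, fun t => by simp [hi, hj, hij]; ring⟩
  · exact ⟨C, 0, le_rfl, fun t => by simp [hi, hj, hij.symm]; ring⟩
  · exact ⟨0, 0, le_rfl, fun t => by simp [hi, hj]⟩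

lemma coe_backProb (hy : y ∈ basePolytope M) (i j : V) :
    (backProb R y i j : ℝ) = hitAmount R y i j / (hitAmount R y i j + hitAmount R y j i) := by
  simp [backProb, hitAmount_nonneg hy]

/-- A move does not increase the expectation of `∏ (1 - y_k)`. -/
lemma expect_pipageMove_le (hy : y ∈ basePolytope M) (hij : i ≠ j) (T A : Finset V) :
    expect (pipageMove R ⟨y, T⟩ i j) (fun s => ENNReal.ofReal (∏ k ∈ A, (1 - s.y k))) ≤
      ENNReal.ofReal (∏ k ∈ A, (1 - y k)) := by
  obtain ⟨β, γ, hγ, hq⟩ := exists_prod_shift_eq (le_one_of_mem_basePolytope hy) hij A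
  have ha := hitAmount_nonneg (R := R) hy i j
  have hb := hitAmount_nonneg (R := R) hy j i
  have hplus := hq (hitAmount R y i j)
  have hminus := hq (-hitAmount R y j i)
  have e1 : ∏ k ∈ A, (1 - hitPoint R y i j k) =
      ∏ k ∈ A, (1 - y k) + β * hitAmount R y i j - γ * hitAmount R y i j ^ 2 := by
    rw [← hplus]; simp_rw [hitPoint_apply]
  have e2 : ∏ k ∈ A, (1 - hitPoint R y j i k) =
      ∏ k ∈ A, (1 - y k) - β * hitAmount R y j i - γ * hitAmount R y j i ^ 2 := by
    rw [show ∏ k ∈ A, (1 - y k) - β * hitAmount R y j i - γ * hitAmount R y j i ^ 2 =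
      ∏ k ∈ A, (1 - y k) + β * (-hitAmount R y j i) - γ * (-hitAmount R y j i) ^ 2 by ring,
      ← hminus]
    refine Finset.prod_congr rfl fun k _ => ?_
    rw [hitPoint_apply]
    split_ifs <;> ring
  have n1 : 0 ≤ ∏ k ∈ A, (1 - hitPoint R y i j k) := Finset.prod_nonneg fun k _ =>
    sub_nonneg.2 (le_one_of_mem_basePolytope (hitPoint_mem_basePolytope hy hij) k)
  have n2 : 0 ≤ ∏ k ∈ A, (1 - hitPoint R y j i k) := Finset.prod_nonneg fun k _ =>
    sub_nonneg.2 (le_one_of_mem_basePolytope (hitPoint_mem_basePolytope hy hij.symm) k)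
  have hp1 := backProb_le_one R y i j
  have hp := coe_backProb (R := R) hy i j
  rw [pipageMove, expect_map, expect_coin]
  simp only [Function.comp_apply, if_true, Bool.false_eq_true, if_false]
  rw [← ENNReal.ofReal_coe_nnreal, ← ENNReal.ofReal_coe_nnreal, ← ENNReal.ofReal_mul (by simp),
    ← ENNReal.ofReal_mul (by simp), ← ENNReal.ofReal_add (by positivity) (by positivity)]
  refine ENNReal.ofReal_le_ofReal ?_
  rw [NNReal.coe_sub hp1, NNReal.coe_one]
  -- The displacement has mean zero, so the linear term `β` cancels. If both amounts vanish, this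
  -- still holds, as both sides are 0.
  have hbal : (backProb R y i j : ℝ) * hitAmount R y j i =
      (1 - backProb R y i j) * hitAmount R y i j := by
    rw [hp]
    rcases (add_nonneg ha hb).eq_or_lt with h | h
    · have h1 : hitAmount R y i j = 0 := by linarith
      have h2 : hitAmount R y j i = 0 := by linarith
      simp [h1, h2]
    · field_simp
      ring
  have hp0 : (0 : ℝ) ≤ backProb R y i j := NNReal.coe_nonneg _
  have hp1' : (0 : ℝ) ≤ 1 - backProb R y i j := sub_nonneg.2 (by exact_mod_cast hp1)
  rw [e1, e2]
  have t1 := mul_nonneg hp0 (mul_nonneg hγ (sq_nonneg (hitAmount R y j i)))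
  have t2 := mul_nonneg hp1' (mul_nonneg hγ (sq_nonneg (hitAmount R y i j)))
  linear_combination t1 + t2 - β * hbal

end Move

/-! ### Termination and negative correlation of pipage rounding -/

section Run

variable {V : Type*} [DecidableEq V] [Fintype V] {M : Matroid V} {R : PipageRule M}

/-- The states that the procedure can reach: the point lies in the base polytope, and the tight set
is tight or exhausted. -/
def IsReachable (M : Matroid V) (s : PipageState V) : Prop :=
  s.y ∈ basePolytope M ∧ (∑ k ∈ s.T, s.y k = rk M s.T ∨ ¬ HasFracPair s.y s.T)

open Classical in
/-- A bound, shifted by `|V|`, on the number of remaining iterations. -/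
noncomputable def potential (s : PipageState V) : ℕ :=
  (fracs s.y).card * Fintype.card V +
    if HasFracPair s.y s.T then s.T.card else Fintype.card V

lemma potential_le (s : PipageState V) :
    potential s ≤ (fracs s.y).card * Fintype.card V + Fintype.card V := by
  unfold potential
  split_ifs
  · exact Nat.add_le_add_left (Finset.card_le_univ _) _
  · exact le_rfl

lemma HasFracPair.mono {y : EuclideanSpace ℝ V} {S T : Finset V} (h : HasFracPair y S)
    (hST : S ⊆ T) : HasFracPair y T := by
  obtain ⟨i, j, hi, hj, h⟩ := h
  exact ⟨i, j, hST hi, hST hj, h⟩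

lemma pipageStep_cases {s : PipageState V} (hs : IsReachable M s) :
    (¬ HasFracPair s.y Finset.univ ∧ pipageStep R s = PMF.pure s) ∨
      ∃ T i j, ∑ k ∈ T, s.y k = rk M T ∧ IsFracPair s.y T i j ∧
        pipageStep R s = pipageMove R ⟨s.y, T⟩ i j ∧
        (fracs s.y).card * Fintype.card V + T.card ≤ potential s := by
  by_cases h1 : HasFracPair s.y s.T
  · right
    refine ⟨s.T, _, _, hs.2.resolve_right (not_not.2 h1), R.pick_spec _ _ h1, ?_, ?_⟩
    · rw [pipageStep, if_pos h1]
    · rw [potential, if_pos h1]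
  by_cases h2 : HasFracPair s.y Finset.univ
  · right
    refine ⟨Finset.univ, _, _, hs.1.2.2, R.pick_spec _ _ h2, ?_, ?_⟩
    · rw [pipageStep, if_neg h1, if_pos h2]
    · rw [potential, if_neg h1, Finset.card_univ]
  · left
    exact ⟨h2, by rw [pipageStep, if_neg h1, if_neg h2]⟩

/-- Either the new set still has a fractional pair and is smaller, or it is exhausted: its term then
jumps to `|V|`, but the loss of a fractional coordinate pays for this with a full `|V|`, and `T.card
> 0` makes the inequality strict. -/
lemma potential_hitPoint_lt {y : EuclideanSpace ℝ V} (hy : y ∈ basePolytope M) {T : Finset V}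
    {i j : V} (hT : ∑ k ∈ T, y k = rk M T) (hf : IsFracPair y T i j) :
    IsReachable M ⟨hitPoint R y i j, T ∩ hitSet R y i j⟩ ∧
      potential ⟨hitPoint R y i j, T ∩ hitSet R y i j⟩ <
        (fracs y).card * Fintype.card V + T.card := by
  obtain ⟨h1, h2, h3⟩ := move_spec (R := R) hy hT hf
  refine ⟨⟨hitPoint_mem_basePolytope hy hf.2.2.1, h2⟩, ?_⟩
  have hk := Finset.card_le_card (fracs_hitPoint_subset (R := R) hf)
  unfold potential
  dsimp only
  split_ifs with h
  · exact Nat.add_lt_add_of_le_of_lt (Nat.mul_le_mul_right _ hk) h1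
  · have h4 := Nat.mul_le_mul_right (Fintype.card V) (Nat.succ_le_of_lt (h3 h))
    rw [Nat.succ_mul] at h4
    have h5 : 0 < T.card := Finset.card_pos.2 ⟨i, hf.1⟩
    omega

lemma mem_support_pipageMove {s s' : PipageState V} {i j : V}
    (h : s' ∈ (pipageMove R s i j).support) :
    s' = ⟨hitPoint R s.y i j, s.T ∩ hitSet R s.y i j⟩ ∨
      s' = ⟨hitPoint R s.y j i, s.T ∩ hitSet R s.y j i⟩ := by
  rw [pipageMove, PMF.mem_support_map_iff] at h
  obtain ⟨b, -, rfl⟩ := h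
  cases b <;> simp

lemma isReachable_of_mem_support {s s' : PipageState V} (hs : IsReachable M s)
    (h : s' ∈ (pipageStep R s).support) :
    IsReachable M s' ∧ (HasFracPair s.y Finset.univ → potential s' < potential s) := by
  rcases pipageStep_cases (R := R) hs with ⟨h1, h2⟩ | ⟨T, i, j, hT, hf, h2, hpot⟩
  · rw [h2, PMF.mem_support_pure_iff] at h
    subst h
    exact ⟨hs, fun h => absurd h h1⟩
  · rw [h2] at h
    rcases mem_support_pipageMove h with rfl | rfl
    · obtain ⟨h3, h4⟩ := potential_hitPoint_lt (R := R) hs.1 hT hf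
      exact ⟨h3, fun _ => h4.trans_le hpot⟩
    · obtain ⟨h3, h4⟩ := potential_hitPoint_lt (R := R) hs.1 hT hf.symm
      exact ⟨h3, fun _ => h4.trans_le hpot⟩

lemma pipageRun_eq_pure {s : PipageState V} (h : ¬ HasFracPair s.y Finset.univ) (n : ℕ) :
    pipageRun R n s = PMF.pure s := by
  induction n with
  | zero => rfl
  | succ n ih =>
    rw [pipageRun, pipageStep, if_neg fun h' => h (h'.mono (Finset.subset_univ _)), if_neg h,
      PMF.pure_bind, ih]

lemma pipageRun_support (n : ℕ) (s : PipageState V) (hs : IsReachable M s)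
    (hpot : potential s ≤ n + Fintype.card V) {s' : PipageState V}
    (h : s' ∈ (pipageRun R n s).support) :
    s'.y ∈ basePolytope M ∧ ¬ HasFracPair s'.y Finset.univ := by
  induction n generalizing s with
  | zero =>
    rw [pipageRun, PMF.mem_support_pure_iff] at h
    subst h
    -- A remaining fractional coordinate already contributes `|V|` to `potential`, and the second
    -- summand is positive, so the bound `|V|` is exceeded.
    refine ⟨hs.1, fun hp => ?_⟩
    obtain ⟨i, j, -, -, -, hi0, hi1, -⟩ := hp
    have hk : 0 < (fracs s'.y).card := Finset.card_pos.2 ⟨i, mem_fracs.2 ⟨hi0, hi1⟩⟩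
    have hn : 0 < Fintype.card V := Fintype.card_pos_iff.2 ⟨i⟩
    have hkn := Nat.le_mul_of_pos_left (Fintype.card V) hk
    unfold potential at hpot
    split_ifs at hpot with hp
    · obtain ⟨a, b, ha, -⟩ := hp
      have : 0 < s'.T.card := Finset.card_pos.2 ⟨a, ha⟩
      omega
    · omega
  | succ n ih =>
    by_cases hdone : HasFracPair s.y Finset.univ
    · rw [pipageRun, PMF.mem_support_bind_iff] at h
      obtain ⟨t, ht, h⟩ := h
      obtain ⟨h1, h2⟩ := isReachable_of_mem_support hs ht
      have := h2 hdone
      exact ih t h1 (by omega) h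
    · rw [pipageRun_eq_pure hdone, PMF.mem_support_pure_iff] at h
      subst h
      exact ⟨hs.1, hdone⟩

lemma isReachable_univ {y : EuclideanSpace ℝ V} (hy : y ∈ basePolytope M) :
    IsReachable M ⟨y, Finset.univ⟩ := ⟨hy, Or.inl hy.2.2⟩

/-- After `|V|^2` iterations the point lies in the base polytope and is integral. -/
lemma pipageRun_integral {y : EuclideanSpace ℝ V} (hy : y ∈ basePolytope M) {s : PipageState V}
    (hs : s ∈ (pipageRun R (Fintype.card V ^ 2) ⟨y, Finset.univ⟩).support) :
    s.y ∈ basePolytope M ∧ ∀ i, s.y i = 0 ∨ s.y i = 1 := by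
  obtain ⟨h1, h2⟩ := pipageRun_support _ _ (isReachable_univ hy)
    ((potential_le _).trans (Nat.add_le_add_right
      (by rw [sq]; exact Nat.mul_le_mul_right _ (Finset.card_le_univ _)) _)) hs
  exact ⟨h1, fun i => integral_of_tight_of_not_hasFracPair h1 h1.2.2 h2 (Finset.mem_univ i)⟩

/-- The product is a supermartingale along the run; reachability keeps the point in the polytope,
where the one-move estimate applies. -/
lemma expect_pipageRun_le (A : Finset V) (n : ℕ) (s : PipageState V) (hs : IsReachable M s) :
    expect (pipageRun R n s) (fun s => ENNReal.ofReal (∏ k ∈ A, (1 - s.y k))) ≤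
      ENNReal.ofReal (∏ k ∈ A, (1 - s.y k)) := by
  induction n generalizing s with
  | zero => rw [pipageRun, expect_pure]
  | succ n ih =>
    rw [pipageRun, expect_bind]
    refine (expect_mono fun t ht => ih t (isReachable_of_mem_support hs ht).1).trans ?_
    rcases pipageStep_cases (R := R) hs with ⟨-, h2⟩ | ⟨T, i, j, -, hf, h2, -⟩
    · rw [h2, expect_pure]
    · rw [h2]
      exact expect_pipageMove_le hs.1 hf.2.2.1 T A

lemma indep_of_mem_support_pipageRound {y : EuclideanSpace ℝ V} (hy : y ∈ basePolytope M)
    {S : Finset V} (hS : S ∈ (pipageRound R y).support) : M.Indep (S : Set V) := by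
  rw [pipageRound, PMF.mem_support_map_iff] at hS
  obtain ⟨s, hs, rfl⟩ := hS
  obtain ⟨hmem, hint⟩ := pipageRun_integral hy hs
  refine indep_of_card_le_rk M _ ((le_of_eq ?_).trans (hmem.2.1 _))
  rw [Finset.card_eq_sum_ones, Nat.cast_sum]
  refine Finset.sum_congr rfl fun i hi => ?_
  rw [(Finset.mem_filter.1 hi).2, Nat.cast_one]

/-- The probability that pipage rounding avoids `A` is at most `∏_{i ∈ A} (1 - y_i)`. -/
lemma sum_pipageRound_disjoint_le {y : EuclideanSpace ℝ V} (hy : y ∈ basePolytope M)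
    (A : Finset V) :
    ∑ S, (pipageRound R y S).toReal * (if Disjoint A S then 1 else 0) ≤ ∏ k ∈ A, (1 - y k) := by
  have h : expect (pipageRound R y) (fun S => if Disjoint A S then 1 else 0) ≤
      ENNReal.ofReal (∏ k ∈ A, (1 - y k)) := by
    rw [pipageRound, expect_map]
    refine (expect_mono fun s hs => ?_).trans (expect_pipageRun_le A _ _ (isReachable_univ hy))
    obtain ⟨-, hint⟩ := pipageRun_integral hy hs
    rw [Function.comp_apply]
    split_ifs with hd
    -- At an integral point, an output disjoint from `A` means that all coordinates in `A` are 0.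
    · rw [Finset.prod_eq_one fun k hk => ?_, ENNReal.ofReal_one]
      have hk' := Finset.disjoint_left.1 hd hk
      simp only [Finset.mem_filter, Finset.mem_univ, true_and] at hk'
      rw [(hint k).resolve_right hk', sub_zero]
    · exact zero_le
  rw [expect, tsum_fintype] at h
  have hnn : 0 ≤ ∏ k ∈ A, (1 - y k) :=
    Finset.prod_nonneg fun k _ => sub_nonneg.2 (le_one_of_mem_basePolytope hy k)
  refine le_trans (le_of_eq ?_) (ENNReal.toReal_le_of_le_ofReal hnn h)
  rw [ENNReal.toReal_sum fun S _ => ENNReal.mul_ne_top (PMF.apply_ne_top _ _) (by split_ifs <;> simp)]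
  refine Finset.sum_congr rfl fun S _ => ?_
  rw [ENNReal.toReal_mul]
  split_ifs <;> simp

lemma sum_toReal_eq_one {α : Type*} [Fintype α] (p : PMF α) : ∑ a, (p a).toReal = 1 := by
  rw [← ENNReal.toReal_sum fun a _ => p.apply_ne_top a, ← tsum_fintype (L := .unconditional _), p.tsum_coe,
    ENNReal.toReal_one]

/-- Pipage rounding loses at most a factor `1 - 1/e` against the concave relaxation. -/
lemma concaveRelax_le_sum_pipageRound {U : Type*} {w : U → ℝ} (hw : ∀ u, 0 ≤ w u)
    (hsum : Summable w) (B : V → Set U) {y : EuclideanSpace ℝ V} (hy : y ∈ basePolytope M) :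
    (1 - 1 / Real.exp 1) * concaveRelax w B y ≤
      ∑ S, (pipageRound R y S).toReal * coverage w B S := by
  simp_rw [concaveRelax_eq_sum hw hsum B, coverage_eq_sum hw hsum B, Finset.mul_sum]
  rw [Finset.sum_comm]
  refine Finset.sum_le_sum fun A _ => ?_
  have h1 := mul_min_one_sum_le_one_sub_prod A (fun i => y i) hy.1 (le_one_of_mem_basePolytope hy)
  have h2 := sum_pipageRound_disjoint_le (R := R) hy A
  have h3 : ∑ S, (pipageRound R y S).toReal * (classWeight w B A * if Disjoint A S then 0 else 1) =
      classWeight w B A *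
        (1 - ∑ S, (pipageRound R y S).toReal * (if Disjoint A S then 1 else 0)) := by
    nth_rw 2 [← sum_toReal_eq_one (pipageRound R y)]
    rw [← Finset.sum_sub_distrib, Finset.mul_sum]
    refine Finset.sum_congr rfl fun S _ => ?_
    split_ifs <;> ring
  rw [h3, mul_left_comm]
  exact mul_le_mul_of_nonneg_left (by linarith) (classWeight_nonneg hw B A)

end Run

/-! ### Projected stochastic subgradient ascent -/

section Ascent

/-- The angle at the projection is obtuse: `⟪y - p, z - p⟫ ≤ 0`. Expanding the square of `(y - p) -
(z - p)` gives the claim. -/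
lemma IsProjection.norm_sub_sq_le {V : Type*} [Fintype V] {K : Set (EuclideanSpace ℝ V)}
    (hK : Convex ℝ K) {y p z : EuclideanSpace ℝ V} (h : IsProjection K y p) (hz : z ∈ K) :
    ‖p - z‖ ^ 2 ≤ ‖y - z‖ ^ 2 := by
  have hne : Nonempty K := ⟨⟨p, h.1⟩⟩
  have hmin : ‖y - p‖ = ⨅ w : K, ‖y - w‖ := by
    refine le_antisymm (le_ciInf fun w => ?_)
      (ciInf_le (f := fun w : K => ‖y - w‖) ⟨0, ?_⟩ ⟨p, h.1⟩)
    · rw [norm_sub_rev y p, norm_sub_rev y w]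
      exact h.2 w w.2
    · rintro _ ⟨w, rfl⟩
      exact norm_nonneg _
  have hin := (norm_eq_iInf_iff_real_inner_le_zero hK h.1).1 hmin z hz
  have hsplit : y - z = (y - p) - (z - p) := by abel
  have hn : ‖p - z‖ = ‖z - p‖ := norm_sub_rev p z
  rw [hsplit, hn, norm_sub_sq_real (y - p)]
  nlinarith [sq_nonneg ‖y - p‖]

lemma integrable_comp_of_mem_basePolytope {V : Type*} [Fintype V] {M : Matroid V} {Ω : Type*}
    [MeasurableSpace Ω] {μ : Measure Ω} [IsProbabilityMeasure μ] {G : EuclideanSpace ℝ V → ℝ}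
    (hG : Continuous G) {z : Ω → EuclideanSpace ℝ V} (hz : Measurable z)
    (hzP : ∀ ω, z ω ∈ basePolytope M) : Integrable (fun ω => G (z ω)) μ := by
  obtain ⟨C, hC⟩ := (isCompact_closedBall (0 : EuclideanSpace ℝ V)
    (polytopeRadius M)).exists_bound_of_continuousOn hG.continuousOn
  refine Integrable.of_bound (hG.measurable.comp hz).aestronglyMeasurable C (ae_of_all _ fun ω => ?_)
  exact hC _ (by simpa using norm_le_polytopeRadius (hzP ω))

variable {V : Type*} [Fintype V] [DecidableEq V] {M : Matroid V}
  {F : EuclideanSpace ℝ V → ℝ} {R : PipageRule M} {η : ℕ → ℝ} {ρ : ℝ} {T : ℕ}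
  {Ω : Type*} [MeasurableSpace Ω] {μ : Measure Ω} [IsProbabilityMeasure μ]
  {x g : ℕ → Ω → EuclideanSpace ℝ V} {S : Ω → Finset V}

namespace IsRun

lemma mem_basePolytope (h : IsRun M F R η ρ T μ x g S) (t : ℕ) (ω : Ω) :
    x t ω ∈ basePolytope M := by
  cases t with
  | zero => exact h.start ω
  | succ t => exact (h.step t ω).1

lemma average_mem_basePolytope (h : IsRun M F R η ρ T μ x g S) (hT : 0 < T) (ω : Ω) :
    average x T ω ∈ basePolytope M := by
  rw [average, Finset.smul_sum]
  refine (convex_basePolytope M).sum_mem (fun _ _ => by positivity) ?_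
    fun t _ => h.mem_basePolytope t ω
  have : (T : ℝ) ≠ 0 := by positivity
  simp [this]

lemma measurable_average (h : IsRun M F R η ρ T μ x g S) : Measurable (average x T) :=
  (Finset.measurable_fun_sum _ fun t _ => h.measurable_x t).const_smul (T : ℝ)⁻¹

lemma integrable_gradient (h : IsRun M F R η ρ T μ x g S) (t : ℕ) : Integrable (g t) μ :=
  Integrable.of_bound (h.measurable_g t).aestronglyMeasurable ρ (h.bounded t)

lemma history_le (h : IsRun M F R η ρ T μ x g S) (t : ℕ) :
    history x t ≤ ‹MeasurableSpace Ω› :=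
  iSup_le fun s => (h.measurable_x s).comap_le

lemma stronglyMeasurable_history (t : ℕ) (z : EuclideanSpace ℝ V) :
    StronglyMeasurable[history x t] fun ω => z - x t ω := by
  have hx : Measurable[history x t] (x t) :=
    Measurable.of_comap_le (le_iSup (fun s : Fin (t + 1) => MeasurableSpace.comap (x s) inferInstance)
      (Fin.last t))
  exact (hx.const_sub z).stronglyMeasurable

lemma integrable_inner_gradient (h : IsRun M F R η ρ T μ x g S) (t : ℕ)
    {z : EuclideanSpace ℝ V} (hz : z ∈ basePolytope M) :
    Integrable (fun ω => inner ℝ (z - x t ω) (g t ω)) μ := by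
  refine Integrable.of_bound (((h.measurable_x t).const_sub z).inner
    (h.measurable_g t)).aestronglyMeasurable ((2 * polytopeRadius M) * ρ) ?_
  filter_upwards [h.bounded t] with ω hω
  have h1 : ‖z - x t ω‖ ≤ 2 * polytopeRadius M := by
    have := norm_sub_le z (x t ω)
    have := norm_le_polytopeRadius hz
    have := norm_le_polytopeRadius (h.mem_basePolytope t ω)
    linarith
  exact (norm_inner_le_norm _ _).trans
    (mul_le_mul h1 hω (norm_nonneg _) ((norm_nonneg _).trans h1))

/-- The stochastic gradient is in expectation an ascent direction towards every `z`. -/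
lemma integral_gap_le (h : IsRun M F R η ρ T μ x g S) (hF : Continuous F) (t : ℕ)
    {z : EuclideanSpace ℝ V} (hz : z ∈ basePolytope M) :
    F z - ∫ ω, F (x t ω) ∂μ ≤ ∫ ω, inner ℝ (z - x t ω) (g t ω) ∂μ := by
  have hint := h.integrable_inner_gradient t hz
  -- The factor `z - x t` is known from the past, so conditioning replaces only `g t`, by its
  -- conditional mean.
  have hpull : μ[fun ω => inner ℝ (z - x t ω) (g t ω) | history x t] =ᵐ[μ]
      fun ω => inner ℝ (z - x t ω) ((μ[g t | history x t]) ω) :=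
    condExp_bilin_of_stronglyMeasurable_left (innerSL ℝ)
      (stronglyMeasurable_history t z) hint (h.integrable_gradient t)
  have hFx : Integrable (fun ω => F (x t ω)) μ :=
    integrable_comp_of_mem_basePolytope hF (h.measurable_x t) (h.mem_basePolytope t)
  rw [← integral_condExp (h.history_le t) (f := fun ω => inner ℝ (z - x t ω) (g t ω))]
  have hconst : F z - ∫ ω, F (x t ω) ∂μ = ∫ ω, (F z - F (x t ω)) ∂μ := by
    rw [integral_sub (integrable_const _) hFx]
    simp
  rw [hconst]
  refine integral_mono_ae ((integrable_const _).sub hFx) integrable_condExp ?_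
  filter_upwards [hpull, h.unbiased t] with ω h1 h2
  have h3 := h2 z (basePolytope_subset_cube M hz)
  rw [h1, real_inner_comm]
  linarith

/-- The expected progress of one ascent step. -/
lemma two_mul_gap_le (h : IsRun M F R η ρ T μ x g S) (hF : Continuous F) (t : ℕ)
    (hη : 0 ≤ η t) {z : EuclideanSpace ℝ V} (hz : z ∈ basePolytope M) :
    2 * η t * (F z - ∫ ω, F (x t ω) ∂μ) ≤
      ∫ ω, ‖x t ω - z‖ ^ 2 ∂μ - ∫ ω, ‖x (t + 1) ω - z‖ ^ 2 ∂μ + η t ^ 2 * ρ ^ 2 := by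
  have hdist : ∀ s, Integrable (fun ω => ‖x s ω - z‖ ^ 2) μ := fun s =>
    integrable_comp_of_mem_basePolytope (G := fun y => ‖y - z‖ ^ 2) (by fun_prop) (h.measurable_x s)
      (h.mem_basePolytope s)
  have hin := h.integrable_inner_gradient t hz
  have hle : ∫ ω, ‖x (t + 1) ω - z‖ ^ 2 ∂μ ≤
      ∫ ω, (‖x t ω - z‖ ^ 2 - 2 * η t * inner ℝ (z - x t ω) (g t ω) + η t ^ 2 * ρ ^ 2) ∂μ := by
    refine integral_mono_ae (hdist _)
      (((hdist t).sub (hin.const_mul _)).add (integrable_const _)) ?_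
    filter_upwards [h.bounded t] with ω hω
    refine ((h.step t ω).norm_sub_sq_le (convex_basePolytope M) hz).trans ?_
    have e : x t ω + η t • g t ω - z = η t • g t ω - (z - x t ω) := by abel
    rw [e, norm_sub_sq_real, real_inner_smul_left, norm_smul, mul_pow, Real.norm_eq_abs, sq_abs,
      real_inner_comm, norm_sub_rev z]
    have := mul_le_mul_of_nonneg_left (pow_le_pow_left₀ (norm_nonneg _) hω 2) (sq_nonneg (η t))
    linarith
  rw [integral_add (by exact (hdist t).sub (hin.const_mul _)) (integrable_const _),
    integral_sub (hdist t) (hin.const_mul _), integral_const_mul] at hle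
  simp only [integral_const, probReal_univ, one_smul] at hle
  have := mul_le_mul_of_nonneg_left (h.integral_gap_le hF t hz) (mul_nonneg zero_le_two hη)
  linarith

end IsRun

/-- Summing the progress bounds `2 η_t d_t ≤ a_t - a_{t+1} + η_t² ρ²` for `η_t = b / (ρ s_t)`. -/
lemma sum_gap_le {a d s : ℕ → ℝ} {b ρ : ℝ} (hb : 0 < b) (hρ : 0 < ρ) (hs : ∀ t, 1 ≤ t → 0 < s t)
    (hmono : Monotone s) (ha : ∀ t, a t ≤ 2 * b ^ 2)
    (h : ∀ t, 2 * (b / (ρ * s t)) * d t ≤ a t - a (t + 1) + (b / (ρ * s t)) ^ 2 * ρ ^ 2)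
    {n : ℕ} (hn : 1 ≤ n) :
    ∑ t ∈ Finset.Icc 1 n, d t ≤ ρ * s n / (2 * b) * (2 * b ^ 2 - a (n + 1)) +
      ρ * b / 2 * ∑ t ∈ Finset.Icc 1 n, (s t)⁻¹ := by
  have hd : ∀ t, 1 ≤ t →
      d t ≤ ρ * s t / (2 * b) * (a t - a (t + 1)) + ρ * b / 2 * (s t)⁻¹ := by
    intro t ht
    have hst := hs t ht
    have hpos : 0 < ρ * s t / (2 * b) := by positivity
    have := mul_le_mul_of_nonneg_left (h t) hpos.le
    have e1 : ρ * s t / (2 * b) * (2 * (b / (ρ * s t)) * d t) = d t := by field_simp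
    have e2 : ρ * s t / (2 * b) * (a t - a (t + 1) + (b / (ρ * s t)) ^ 2 * ρ ^ 2) =
        ρ * s t / (2 * b) * (a t - a (t + 1)) + ρ * b / 2 * (s t)⁻¹ := by field_simp
    rwa [e1, e2] at this
  -- Summation by parts as an induction. Keeping `2 * b ^ 2 - a (n + 1)` in the bound is what allows
  -- the step: this slack is nonnegative, so its weight may be raised from `s n` to `s (n + 1)`,
  -- after which `a (n + 1)` cancels.
  induction n, hn using Nat.le_induction with
  | base =>
    have h1 := hd 1 le_rfl
    have h2 : 0 ≤ ρ * s 1 / (2 * b) := by have := hs 1 le_rfl; positivity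
    simp only [Finset.Icc_self, Finset.sum_singleton]
    nlinarith [ha 1]
  | succ n hn ih =>
    rw [Finset.sum_Icc_succ_top (by omega), Finset.sum_Icc_succ_top (by omega)]
    have h1 := hd (n + 1) (by omega)
    have h2 : ρ * s n / (2 * b) ≤ ρ * s (n + 1) / (2 * b) := by
      have := hmono n.le_succ
      gcongr
    have h3 := mul_le_mul_of_nonneg_right h2 (sub_nonneg.2 (ha (n + 1)))
    linarith

lemma sum_inv_sqrt_succ_le (n : ℕ) :
    ∑ t ∈ Finset.Icc 1 n, (√((t : ℝ) + 1))⁻¹ ≤ 2 * (√((n : ℝ) + 1) - 1) := by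
  induction n with
  | zero => simp
  | succ n ih =>
    rw [Finset.sum_Icc_succ_top (by omega)]
    push_cast
    set p := √((n : ℝ) + 1)
    set q := √((n : ℝ) + 1 + 1)
    have hp : p ^ 2 = n + 1 := Real.sq_sqrt (by positivity)
    have hq : q ^ 2 = n + 1 + 1 := Real.sq_sqrt (by positivity)
    have hq0 : 0 < q := Real.sqrt_pos.2 (by positivity)
    -- Since `q ^ 2 - p ^ 2 = 1`, one has `2 * q * (q - p) = (q - p) ^ 2 + 1 ≥ 1`.
    have : q⁻¹ ≤ 2 * (q - p) := by
      rw [inv_le_iff_one_le_mul₀ hq0]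
      nlinarith [sq_nonneg (q - p)]
    linarith

variable {ε : ℝ}

/-- The average of the expected optimality gaps is at most `3 ε / 2`. -/
lemma IsRun.sum_gap_le (h : IsRun M F R η ρ T μ x g S) (hF : Continuous F) (hρ : 0 < ρ)
    (hε : 0 < ε) (hT : 0 < T)
    (hη : ((∀ t, η t = polytopeRadius M / (ρ * √T)) ∧
            polytopeRadius M ^ 2 * ρ ^ 2 / ε ^ 2 ≤ T) ∨
          ((∀ t, η t = polytopeRadius M / (ρ * √(t + 1))) ∧
            2 * (polytopeRadius M ^ 2 * ρ ^ 2 / ε ^ 2) ≤ T))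
    {z : EuclideanSpace ℝ V} (hz : z ∈ basePolytope M) :
    ∑ t ∈ Finset.Icc 1 T, (F z - ∫ ω, F (x t ω) ∂μ) ≤ T * (3 / 2 * ε) := by
  have hTpos : (1 : ℝ) ≤ T := by exact_mod_cast hT
  rcases (polytopeRadius_nonneg M).eq_or_lt with hb | hb
  -- With radius 0 the steps vanish and dividing by `η t` is impossible, but the polytope is then at
  -- most the origin and every gap is 0.
  · have h0 : ∀ y ∈ basePolytope M, y = 0 := fun y hy =>
      norm_le_zero_iff.1 (hb ▸ norm_le_polytopeRadius hy)
    have : ∀ t ∈ Finset.Icc 1 T, F z - ∫ ω, F (x t ω) ∂μ = 0 := fun t _ => by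
      simp_rw [h0 z hz, h0 _ (h.mem_basePolytope t _)]
      simp
    rw [Finset.sum_eq_zero this]
    positivity
  have hη0 : ∀ t, 0 ≤ η t := fun t => by
    rcases hη with ⟨hη, -⟩ | ⟨hη, -⟩ <;> rw [hη] <;> positivity
  set b := polytopeRadius M
  set a : ℕ → ℝ := fun t => ∫ ω, ‖x t ω - z‖ ^ 2 ∂μ
  have ha0 : ∀ t, 0 ≤ a t := fun t => integral_nonneg fun ω => sq_nonneg _
  have ha : ∀ t, a t ≤ 2 * b ^ 2 := fun t => by
    have : a t ≤ ∫ _ω, 2 * b ^ 2 ∂μ := integral_mono_of_nonneg (ae_of_all _ fun ω => sq_nonneg _)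
      (integrable_const _)
      (ae_of_all _ fun ω => norm_sub_sq_le_of_mem_basePolytope (h.mem_basePolytope t ω) hz)
    simpa using this
  have hstep := fun t => h.two_mul_gap_le hF t (hη0 t) hz
  set q := √(T : ℝ)
  have hq : q ^ 2 = T := Real.sq_sqrt (by positivity)
  have hq1 : 1 ≤ q := Real.one_le_sqrt.2 hTpos
  have hbound : ∀ s : ℕ → ℝ, (∀ t, 1 ≤ t → 0 < s t) → Monotone s → (∀ t, η t = b / (ρ * s t)) →
      ∑ t ∈ Finset.Icc 1 T, (F z - ∫ ω, F (x t ω) ∂μ) ≤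
        ρ * b * (s T + 1 / 2 * ∑ t ∈ Finset.Icc 1 T, (s t)⁻¹) := by
    intro s hs hm hηs
    have h1 := StochSubmod.sum_gap_le (a := a) hb hρ hs hm ha
      (fun t => by rw [← hηs]; exact hstep t) (Nat.succ_le_of_lt hT)
    have h2 : ρ * s T / (2 * b) * (2 * b ^ 2 - a (T + 1)) ≤ ρ * s T / (2 * b) * (2 * b ^ 2) := by
      have := hs T hT
      exact mul_le_mul_of_nonneg_left (by linarith [ha0 (T + 1)]) (by positivity)
    have h3 : ρ * s T / (2 * b) * (2 * b ^ 2) = ρ * b * s T := by field_simp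
    linarith
  rcases hη with ⟨hη, hTε⟩ | ⟨hη, hTε⟩
  · refine (hbound (fun _ => q) (fun _ _ => by positivity) monotone_const hη).trans ?_
    have h1 : ρ * b ≤ ε * q := by
      rw [div_le_iff₀ (by positivity), ← hq] at hTε
      exact le_of_sq_le_sq (by nlinarith) (by positivity)
    have h2 : ∑ _t ∈ Finset.Icc 1 T, q⁻¹ = q := by
      rw [Finset.sum_const, Nat.card_Icc, Nat.add_sub_cancel, nsmul_eq_mul, ← hq]
      field_simp
    rw [h2, ← hq]
    nlinarith [mul_le_mul_of_nonneg_right h1 (by positivity : 0 ≤ q)]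
  · refine (hbound (fun t => √((t : ℝ) + 1)) (fun _ _ => by positivity)
      (fun i j hij => Real.sqrt_le_sqrt (by gcongr)) hη).trans ?_
    -- The hypothesis gives the factor `1 / √2 ≤ 3 / 4`; together with the bound `2 * q` in `h3`
    -- this makes `3 / 2`, as for constant steps.
    have h1 : ρ * b ≤ 3 / 4 * (ε * q) := by
      have h1 : 2 * (b ^ 2 * ρ ^ 2) ≤ T * ε ^ 2 := by
        rw [← mul_div_assoc, div_le_iff₀ (by positivity)] at hTε
        exact hTε
      rw [← hq] at h1
      have : 0 ≤ (ε * q) ^ 2 := sq_nonneg _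
      exact le_of_sq_le_sq (by nlinarith) (by positivity)
    have h2 := sum_inv_sqrt_succ_le T
    have h3 : √((T : ℝ) + 1) + 1 / 2 * ∑ t ∈ Finset.Icc 1 T, (√((t : ℝ) + 1))⁻¹ ≤ 2 * q := by
      have h4 : √((T : ℝ) + 1) ≤ q + 1 / 2 := Real.sqrt_le_iff.2 ⟨by positivity, by nlinarith⟩
      linarith
    refine (mul_le_mul_of_nonneg_left h3 (by positivity)).trans ?_
    rw [← hq]
    nlinarith [mul_le_mul_of_nonneg_right h1 (by positivity : 0 ≤ q)]

/-- The average iterate is optimal for the concave function up to `3 ε / 2` in expectation. -/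
lemma IsRun.le_integral_average (h : IsRun M F R η ρ T μ x g S) (hF : Continuous F)
    (hconc : ConcaveOn ℝ Set.univ F) (hρ : 0 < ρ) (hε : 0 < ε) (hT : 0 < T)
    (hη : ((∀ t, η t = polytopeRadius M / (ρ * √T)) ∧
            polytopeRadius M ^ 2 * ρ ^ 2 / ε ^ 2 ≤ T) ∨
          ((∀ t, η t = polytopeRadius M / (ρ * √(t + 1))) ∧
            2 * (polytopeRadius M ^ 2 * ρ ^ 2 / ε ^ 2) ≤ T))
    {z : EuclideanSpace ℝ V} (hz : z ∈ basePolytope M) :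
    F z - 3 / 2 * ε ≤ ∫ ω, F (average x T ω) ∂μ := by
  have hTpos : (0 : ℝ) < T := by exact_mod_cast hT
  have hFx : ∀ t, Integrable (fun ω => F (x t ω)) μ := fun t =>
    integrable_comp_of_mem_basePolytope hF (h.measurable_x t) (h.mem_basePolytope t)
  have hjensen : ∫ ω, ∑ t ∈ Finset.Icc 1 T, (T : ℝ)⁻¹ * F (x t ω) ∂μ ≤
      ∫ ω, F (average x T ω) ∂μ := by
    refine integral_mono (integrable_finsetSum _ fun t _ => (hFx t).const_mul _)
      (integrable_comp_of_mem_basePolytope hF h.measurable_average (h.average_mem_basePolytope hT)) fun ω => ?_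
    dsimp only
    rw [average, Finset.smul_sum]
    refine hconc.le_map_sum (fun _ _ => by positivity) ?_ fun _ _ => Set.mem_univ _
    simp [hTpos.ne']
  rw [integral_finsetSum _ fun t _ => (hFx t).const_mul _] at hjensen
  simp_rw [integral_const_mul, ← Finset.mul_sum] at hjensen
  have hgap := h.sum_gap_le hF hρ hε hT hη hz
  rw [Finset.sum_sub_distrib, Finset.sum_const, Nat.card_Icc, Nat.add_sub_cancel,
    nsmul_eq_mul] at hgap
  refine le_trans ?_ hjensen
  rw [inv_mul_eq_div, le_div_iff₀ hTpos]
  linarith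

end Ascent

/-! ### Rounding the average iterate -/

section Rounding

variable {V : Type*} [Fintype V] [DecidableEq V] {M : Matroid V}
  {F : EuclideanSpace ℝ V → ℝ} {R : PipageRule M} {η : ℕ → ℝ} {ρ : ℝ} {T : ℕ}
  {Ω : Type*} [MeasurableSpace Ω] {μ : Measure Ω} [IsProbabilityMeasure μ]
  {x g : ℕ → Ω → EuclideanSpace ℝ V} {S : Ω → Finset V}

namespace IsRun

lemma measurableSet_preimage (h : IsRun M F R η ρ T μ x g S) (A : Finset V) :
    MeasurableSet (S ⁻¹' {A}) := h.measurable_S (measurableSet_singleton A)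

/-- The rule `R` is arbitrary, so measurability of the rounding law in the starting point is not
available directly; it is inherited, almost everywhere, from the conditional expectation in `round`.
-/
lemma integrable_pipageRound (h : IsRun M F R η ρ T μ x g S) (A : Finset V) :
    Integrable (fun ω => (pipageRound R (average x T ω) A).toReal) μ :=
  integrable_condExp.congr (h.round A)

lemma measureReal_preimage (h : IsRun M F R η ρ T μ x g S) (A : Finset V) :
    μ.real (S ⁻¹' {A}) = ∫ ω, (pipageRound R (average x T ω) A).toReal ∂μ := by
  rw [← integral_congr_ae (h.round A), integral_condExp h.measurable_average.comap_le,
    integral_indicator (h.measurableSet_preimage A)]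
  simp

lemma ae_indep (h : IsRun M F R η ρ T μ x g S) (hT : 0 < T) :
    ∀ᵐ ω ∂μ, M.Indep (S ω : Set V) := by
  have hA : ∀ A : Finset V, ∀ᵐ ω ∂μ, S ω = A → M.Indep (A : Set V) := by
    intro A
    by_cases hind : M.Indep (A : Set V)
    · exact ae_of_all _ fun _ _ => hind
    have h0 : ∀ ω, pipageRound R (average x T ω) A = 0 := fun ω => by
      by_contra hne
      exact hind (indep_of_mem_support_pipageRound (h.average_mem_basePolytope hT ω)
        ((PMF.mem_support_iff _ _).2 hne))
    have hreal := h.measureReal_preimage A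
    simp only [h0, ENNReal.toReal_zero, integral_zero] at hreal
    rw [measureReal_eq_zero_iff] at hreal
    filter_upwards [measure_eq_zero_iff_ae_notMem.1 hreal] with ω hω hS
    exact absurd hS hω
  filter_upwards [ae_all_iff.2 hA] with ω hω
  exact hω _ rfl

lemma integral_comp_eq (h : IsRun M F R η ρ T μ x g S) (f : Finset V → ℝ) :
    ∫ ω, f (S ω) ∂μ = ∫ ω, ∑ A, (pipageRound R (average x T ω) A).toReal * f A ∂μ := by
  rw [integral_finsetSum _ fun A _ => (h.integrable_pipageRound A).mul_const _]
  simp_rw [integral_mul_const, ← h.measureReal_preimage]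
  have hsplit : ∀ ω, f (S ω) = ∑ A, (S ⁻¹' {A}).indicator (fun _ => f A) ω := fun ω => by
    have h0 : ∀ A ≠ S ω, (S ⁻¹' {A}).indicator (fun _ => f A) ω = 0 := fun A hA =>
      Set.indicator_of_notMem (fun hmem => hA (Eq.symm hmem)) _
    rw [Fintype.sum_eq_single (S ω) h0, Set.indicator_of_mem (by rfl)]
  rw [integral_congr_ae (ae_of_all _ hsplit), integral_finsetSum _ fun A _ => (integrable_const _).indicator (h.measurableSet_preimage A)]
  refine Finset.sum_congr rfl fun A _ => ?_
  rw [integral_indicator_const _ (h.measurableSet_preimage A), smul_eq_mul]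

end IsRun

end Rounding

end StochSubmod

open StochSubmod
theorem theorem1 {U V : Type*} [Fintype V] [DecidableEq V]
    (M : Matroid V) (hE : M.E = Set.univ)
    (w : U → ℝ) (hw : ∀ u, 0 ≤ w u) (hsum : Summable w) (B : V → Set U)
    (R : PipageRule M) (η : ℕ → ℝ) (ρ ε : ℝ) (hρ : 0 < ρ) (hε : 0 < ε) (T : ℕ) (hT : 0 < T)
    {Ω : Type*} [MeasurableSpace Ω] (μ : Measure Ω) [IsProbabilityMeasure μ]
    (x g : ℕ → Ω → EuclideanSpace ℝ V) (S : Ω → Finset V)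
    (hrun : IsRun M (concaveRelax w B) R η ρ T μ x g S)
    (hη : ((∀ t, η t = polytopeRadius M / (ρ * Real.sqrt T)) ∧
            polytopeRadius M ^ 2 * ρ ^ 2 / ε ^ 2 ≤ T) ∨
          ((∀ t, η t = polytopeRadius M / (ρ * Real.sqrt (t + 1))) ∧
            2 * (polytopeRadius M ^ 2 * ρ ^ 2 / ε ^ 2) ≤ T)) :
    (∀ y ∈ basePolytope M, ∀ s ∈ (pipageRun R (Fintype.card V ^ 2) ⟨y, Finset.univ⟩).support,
        ∀ i, s.y i = 0 ∨ s.y i = 1) ∧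
      (∀ᵐ ω ∂μ, M.Indep (S ω : Set V)) ∧
      (1 - 1 / Real.exp 1) * optValue M (coverage w B) - ε ≤
        ∫ ω, coverage w B (S ω) ∂μ := by
  refine ⟨fun y hy s hs => (pipageRun_integral hy hs).2, hrun.ae_indep hT, ?_⟩
  have hcont := continuous_concaveRelax hw hsum B
  obtain ⟨z, hz, hopt⟩ := exists_optValue_le_concaveRelax hw hsum B M
  have hsgd := hrun.le_integral_average hcont (concaveOn_concaveRelax hw hsum B) hρ hε hT hη hz
  have hround : (1 - 1 / Real.exp 1) * ∫ ω, concaveRelax w B (average x T ω) ∂μ ≤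
      ∫ ω, coverage w B (S ω) ∂μ := by
    rw [hrun.integral_comp_eq, ← integral_const_mul]
    exact integral_mono ((integrable_comp_of_mem_basePolytope hcont hrun.measurable_average
        (hrun.average_mem_basePolytope hT)).const_mul _)
      (integrable_finsetSum _ fun A _ => (hrun.integrable_pipageRound A).mul_const _)
      fun ω => concaveRelax_le_sum_pipageRound hw hsum B (hrun.average_mem_basePolytope hT ω)
  have he1 : 1 / Real.exp 1 ≤ 1 := by
    rw [div_le_one (Real.exp_pos 1)]
    exact Real.one_le_exp zero_le_one
  -- Exactly what is needed to absorb the ascent error: `(1 - 1/e) * (3/2 * ε) ≤ ε`.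
  have he3 : 1 / 3 ≤ 1 / Real.exp 1 :=
    one_div_le_one_div_of_le (Real.exp_pos 1) (by linarith [Real.exp_one_lt_d9])
  have h1 := mul_le_mul_of_nonneg_left (hsgd.trans' (sub_le_sub_right hopt _)) (sub_nonneg.2 he1)
  have h2 := mul_le_mul_of_nonneg_right he3 hε.le
  linarith
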